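/- Let $A$ be a (not necessarily unital) $\mathrm{C}^*$-algebra. Let $\mathrm{Ped}(A)_0$ be the set of positive $a\in A$ for which there is a positive $e\in A$ with $ea=a$, let $\mathrm{Ped}(A)_+$ be the set of positive elements of $A$ dominated by a finite sum of elements of $\mathrm{Ped}(A)_0$, and let the Pedersen ideal $\mathrm{Ped}(A)$ be the complex linear span of $\mathrm{Ped}(A)_+$. Equip $\mathrm{Ped}(A)$ with the finest locally convex vector space topology for which the inclusion $D\hookrightarrow \mathrm{Ped}(A)$ is continuous for every $\mathrm{C}^*$-subalgebra $D$ of $A$ with $D\subseteq\mathrm{Ped}(A)$, where $D$ carries its norm topology, and equip the real subspace $\mathrm{Ped}(A)_{\mathrm{sa}}$ of self-adjoint elements with the subspace topology. Let $T_{\mathbb R}(A)$ be the real vector space of continuous linear functionals $\tau\colon \mathrm{Ped}(A)\to\mathbb C$ satisfying $\tau(xy)=\tau(yx)$ and $\tau(x^*)=\overline{\tau(x)}$ for all $x,y\in\mathrm{Ped}(A)$, equipped with the weak$^*$-topology (pointwise convergence on $\mathrm{Ped}(A)$). Let $T_{\mathbb R}(A)^*$ be the space of continuous real-linear functionals $T_{\mathbb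 R}(A)\to\mathbb R$, with the compact-open topology (uniform convergence on compact subsets of $T_{\mathbb R}(A)$). For $a\in \mathrm{Ped}(A)_{\mathrm{sa}}$ let $\hat a\in T_{\mathbb R}(A)^*$ be given by $\hat a(\tau)=\tau(a)$. Let $T_{\leq 1}(A)\subseteq T_{\mathbb R}(A)$ be the set of those $\tau$ with $\tau(a)\ge 0$ for all $a\in\mathrm{Ped}(A)$ that are positive in $A$, and $|\tau(a)|\le\|a\|$ for all $a\in \mathrm{Ped}(A)$, where $\|\cdot\|$ is the norm of $A$. Then the linear map $\mathrm{Ped}(A)_{\mathrm{sa}}\to T_{\mathbb R}(A)^*$, $a\mapsto\hat a$, is a quotient map of locally convex spaces: it is surjective, and a subset of $T_{\mathbb R}(A)^*$ is open if and only if its preimage in $\mathrm{Ped}(A)_{\mathrm{sa}}$ is open. Moreover, for every $f\in T_{\mathbb R}(A)^*$ the supremum $\sup_{\tau\in T_{\leq 1}(A)}|f(\tau)|$ is finite, and for every $\epsilon>0$ there is $a\in\mathrm{Ped}(A)_{\mathrm{sa}}$ such that $f=\hat a$ and $$\|a\|\le \sup_{\tau\in T_{\leq 1}(A)}|f(\tau)|+\epsilon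 .$$ -/

import Mathlib

open scoped CompactConvergenceCLM

namespace PedersenTrace

section PedersenIdeal

variable (A : Type*) [NonUnitalCStarAlgebra A] [PartialOrder A] [StarOrderedRing A]

/-- `Ped(A)₀`: positive elements with a positive local unit. -/
def pedZero : Set A := {a | 0 ≤ a ∧ ∃ e : A, 0 ≤ e ∧ e * a = a}

/-- `Ped(A)₊`: the hereditary cone generated by `Ped(A)₀`, i.e. the positive elements that are
dominated by a finite sum of elements of `Ped(A)₀`. -/
def pedPos : Set A := {a | 0 ≤ a ∧ ∃ l : List A, (∀ b ∈ l, b ∈ pedZero A) ∧ a ≤ l.sum}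

variable {A}

theorem pedPos_of_le {a b : A} (ha : 0 ≤ a) (hb : b ∈ pedPos A) (hab : a ≤ b) : a ∈ pedPos A := by
  obtain ⟨-, l, hl, hbl⟩ := hb
  exact ⟨ha, l, hl, hab.trans hbl⟩

theorem pedPos_add {a b : A} (ha : a ∈ pedPos A) (hb : b ∈ pedPos A) : a + b ∈ pedPos A := by
  obtain ⟨ha, l, hl, hal⟩ := ha
  obtain ⟨hb, m, hm, hbm⟩ := hb
  refine ⟨add_nonneg ha hb, l ++ m, ?_, ?_⟩
  · intro x hx
    rcases List.mem_append.1 hx with h | h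
    exacts [hl x h, hm x h]
  · rw [List.sum_append]
    exact add_le_add hal hbm

theorem pedPos_smul {a : A} (n : ℕ) (ha : a ∈ pedPos A) : n • a ∈ pedPos A := by
  induction n with
  | zero => exact ⟨by simp, [], by simp, by simp⟩
  | succ n ih => rw [succ_nsmul]; exact pedPos_add ih ha

theorem pedPos_map (φ : A →⋆ₙₐ[ℂ] A) {a : A} (ha : a ∈ pedPos A) : φ a ∈ pedPos A := by
  have hφ : ∀ {x y : A}, x ≤ y → φ x ≤ φ y := fun h => OrderHomClass.mono φ h
  have hφ0 : ∀ {x : A}, 0 ≤ x → 0 ≤ φ x := fun h => by simpa using hφ h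
  obtain ⟨ha, l, hl, hal⟩ := ha
  refine ⟨hφ0 ha, l.map φ, ?_, ?_⟩
  · intro b hb
    obtain ⟨c, hc, rfl⟩ := List.mem_map.1 hb
    obtain ⟨hc0, e, he, hec⟩ := hl c hc
    exact ⟨hφ0 hc0, φ e, hφ0 he, by rw [← map_mul, hec]⟩
  · rw [← map_list_sum]
    exact hφ hal

/-- Conjugation by a unitary of the unitization. -/
theorem exists_conj (u : Unitization ℂ A) (hu : u ∈ unitary (Unitization ℂ A)) :
    ∃ φ : A →⋆ₙₐ[ℂ] A, ∀ a : A,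
      ((φ a : A) : Unitization ℂ A) = star u * (a : Unitization ℂ A) * u := by
  have ex : ∀ a : A, ∃ b : A, (b : Unitization ℂ A) = star u * (a : Unitization ℂ A) * u := by
    intro a
    refine ⟨(star u * (a : Unitization ℂ A) * u).snd, ?_⟩
    apply Unitization.ext <;> simp
  choose f key using ex
  have inj : ∀ {x y : A}, (x : Unitization ℂ A) = y → x = y :=
    fun h => Unitization.inr_injective h
  refine ⟨{ toFun := f
            map_smul' := ?_, map_zero' := ?_, map_add' := ?_, map_mul' := ?_, map_star' := ?_ },
          key⟩
  · intro c a
    apply inj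
    simp only [MonoidHom.id_apply, Unitization.inr_smul, key]
    rw [mul_smul_comm, smul_mul_assoc]
  · apply inj
    simp [key]
  · intro a b
    apply inj
    simp only [Unitization.inr_add, key]
    rw [mul_add, add_mul]
  · intro a b
    apply inj
    simp only [Unitization.inr_mul, key]
    have h : u * star u = 1 := (Unitary.mem_iff.1 hu).2
    calc star u * ((a : Unitization ℂ A) * b) * u
        = star u * a * 1 * b * u := by simp only [mul_assoc, mul_one]
      _ = star u * a * u * (star u * b * u) := by rw [← h]; simp only [mul_assoc]
  · intro a
    apply inj
    simp only [Unitization.inr_star, key, star_mul, star_star, mul_assoc]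

/-- The elements `x` with `x⋆x ∈ Ped(A)₊`. -/
def pedHalf (A : Type*) [NonUnitalCStarAlgebra A] [PartialOrder A] [StarOrderedRing A] : Set A :=
  {x | star x * x ∈ pedPos A}

theorem pedHalf_add {x y : A} (hx : x ∈ pedHalf A) (hy : y ∈ pedHalf A) : x + y ∈ pedHalf A := by
  refine pedPos_of_le (star_mul_self_nonneg _) (pedPos_smul 2 (pedPos_add hx hy)) ?_
  have h : 0 ≤ star (x - y) * (x - y) := star_mul_self_nonneg _
  have e : 2 • (star x * x + star y * y) - star (x + y) * (x + y) = star (x - y) * (x - y) := by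
    simp only [star_add, star_sub, add_mul, mul_add, sub_mul, mul_sub, two_nsmul]
    abel
  rw [← sub_nonneg, e]
  exact h

theorem pedPos_real_smul {a : A} (r : ℝ) (hr : 0 ≤ r) (ha : a ∈ pedPos A) : r • a ∈ pedPos A := by
  obtain ⟨n, hn⟩ := exists_nat_ge r
  refine pedPos_of_le (smul_nonneg hr ha.1) (pedPos_smul n ha) ?_
  rw [← Nat.cast_smul_eq_nsmul ℝ]
  exact smul_le_smul_of_nonneg_right hn ha.1

theorem pedHalf_smul {x : A} (c : ℂ) (hx : x ∈ pedHalf A) : c • x ∈ pedHalf A := by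
  have e : star (c • x) * (c • x) = (‖c‖ ^ 2 : ℝ) • (star x * x) := by
    rw [star_smul, smul_mul_smul_comm, ← Complex.coe_smul]
    congr 1
    simp [Complex.conj_mul']
  change star (c • x) * (c • x) ∈ pedPos A
  rw [e]
  exact pedPos_real_smul _ (by positivity) hx

theorem pedHalf_mul_right {x : A} (hx : x ∈ pedHalf A) (a : A) : x * a ∈ pedHalf A := by
  have inj : ∀ {x y : A}, (x : Unitization ℂ A) = y → x = y :=
    fun h => Unitization.inr_injective h
  have key : ∀ v ∈ Submodule.span ℂ (unitary (Unitization ℂ A) : Set (Unitization ℂ A)),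
      ∃ y ∈ pedHalf A, (y : Unitization ℂ A) = (x : Unitization ℂ A) * v := by
    intro v hv
    induction hv using Submodule.span_induction with
    | mem u hu =>
      obtain ⟨φ, hφ⟩ := exists_conj u hu
      have e : (((x : Unitization ℂ A) * u).snd : Unitization ℂ A) = (x : Unitization ℂ A) * u := by
        apply Unitization.ext <;> simp
      refine ⟨((x : Unitization ℂ A) * u).snd, ?_, e⟩
      have e2 : star ((x : Unitization ℂ A) * u).snd * ((x : Unitization ℂ A) * u).snd
          = φ (star x * x) := by
        apply inj
        rw [Unitization.inr_mul, Unitization.inr_star, e, hφ, Unitization.inr_mul,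
          Unitization.inr_star, star_mul]
        simp only [mul_assoc]
      change _ ∈ pedPos A
      rw [e2]
      exact pedPos_map φ hx
    | zero => exact ⟨0, ⟨by simp, [], by simp, by simp⟩, by simp⟩
    | add v w _ _ hv hw =>
      obtain ⟨y, hy, hy'⟩ := hv
      obtain ⟨z, hz, hz'⟩ := hw
      exact ⟨y + z, pedHalf_add hy hz, by rw [Unitization.inr_add, hy', hz', mul_add]⟩
    | smul c v _ hv =>
      obtain ⟨y, hy, hy'⟩ := hv
      exact ⟨c • y, pedHalf_smul c hy, by rw [Unitization.inr_smul, hy', mul_smul_comm]⟩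
  obtain ⟨y, hy, hy'⟩ := key (a : Unitization ℂ A) (by
    rw [CStarAlgebra.span_unitary]; exact Submodule.mem_top)
  rw [← Unitization.inr_mul] at hy'
  rwa [← inj hy']

theorem star_mul_mem_span {x y : A} (hx : x ∈ pedHalf A) (hy : y ∈ pedHalf A) :
    star y * x ∈ Submodule.span ℂ (pedPos A) := by
  have h : ∀ c : ℂ, star (x + c • y) * (x + c • y) ∈ Submodule.span ℂ (pedPos A) :=
    fun c => Submodule.subset_span (pedHalf_add hx (pedHalf_smul c hy))
  have e : star y * x = (4⁻¹ : ℂ) • (star (x + (1 : ℂ) • y) * (x + (1 : ℂ) • y)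
      - star (x + (-1 : ℂ) • y) * (x + (-1 : ℂ) • y)
      + Complex.I • (star (x + Complex.I • y) * (x + Complex.I • y))
      - Complex.I • (star (x + (-Complex.I) • y) * (x + (-Complex.I) • y))) := by
    simp only [star_add, star_smul, add_mul, mul_add, smul_mul_assoc, mul_smul_comm, smul_add,
      smul_smul, star_neg, star_one]
    simp only [Complex.star_def, Complex.conj_I]
    match_scalars <;> ring_nf <;> simp <;> ring_nf
  rw [e]
  exact Submodule.smul_mem _ _ (Submodule.sub_mem _ (Submodule.add_mem _
    (Submodule.sub_mem _ (h _) (h _)) (Submodule.smul_mem _ _ (h _)))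
    (Submodule.smul_mem _ _ (h _)))

theorem mul_mem_span (a : A) {b : A} (hb : b ∈ Submodule.span ℂ (pedPos A)) :
    a * b ∈ Submodule.span ℂ (pedPos A) := by
  induction hb using Submodule.span_induction with
  | mem b hb =>
    have hs : star (CFC.sqrt b) = CFC.sqrt b := (CFC.sqrt_nonneg b).isSelfAdjoint
    have hss : CFC.sqrt b * CFC.sqrt b = b := CFC.sqrt_mul_sqrt_self b hb.1
    have hsq : CFC.sqrt b ∈ pedHalf A := by
      change star (CFC.sqrt b) * CFC.sqrt b ∈ pedPos A
      rwa [hs, hss]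
    have := star_mul_mem_span hsq (pedHalf_mul_right hsq (star a))
    rwa [star_mul, star_star, hs, mul_assoc, hss] at this
  | zero => simp
  | add x y _ _ hx hy => rw [mul_add]; exact Submodule.add_mem _ hx hy
  | smul c x _ hx => rw [mul_smul_comm]; exact Submodule.smul_mem _ _ hx

theorem star_mem_span {b : A} (hb : b ∈ Submodule.span ℂ (pedPos A)) :
    star b ∈ Submodule.span ℂ (pedPos A) := by
  induction hb using Submodule.span_induction with
  | mem b hb => rw [hb.1.star_eq]; exact Submodule.subset_span hb
  | zero => simp
  | add x y _ _ hx hy => rw [star_add]; exact Submodule.add_mem _ hx hy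
  | smul c x _ hx => rw [star_smul]; exact Submodule.smul_mem _ _ hx

variable (A)

/-- The Pedersen ideal of `A`, as a (not necessarily closed) `*`-subalgebra of `A`: the complex
linear span of `Ped(A)₊`. -/
def pedersenIdeal : NonUnitalStarSubalgebra ℂ A where
  __ := Submodule.span ℂ (pedPos A)
  mul_mem' := fun {a _} _ hb => mul_mem_span a hb
  star_mem' := fun hb => star_mem_span hb

/-- The Pedersen ideal as a type. It does not carry the norm topology of `A`, but the locally
convex inductive limit topology introduced below. -/
def Ped : Type _ := ↥(pedersenIdeal A)

namespace Ped

instance : NonUnitalRing (Ped A) := inferInstanceAs (NonUnitalRing ↥(pedersenIdeal A))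
instance : Module ℂ (Ped A) := inferInstanceAs (Module ℂ ↥(pedersenIdeal A))
instance : StarRing (Ped A) := inferInstanceAs (StarRing ↥(pedersenIdeal A))
instance : StarModule ℂ (Ped A) := inferInstanceAs (StarModule ℂ ↥(pedersenIdeal A))

variable {A}

/-- The underlying element of `A`. -/
def val (x : Ped A) : A := Subtype.val (p := fun a => a ∈ pedersenIdeal A) x

/-- The inclusion into `Ped(A)` of a `*`-subalgebra `D` of `A` that is contained in `Ped(A)`. -/
def incl (D : NonUnitalStarSubalgebra ℂ A) (hD : D ≤ pedersenIdeal A) (d : D) : Ped A :=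
  (⟨d.1, hD d.2⟩ : ↥(pedersenIdeal A))

/-- The locally convex inductive limit topology on `Ped(A)`: the finest locally convex vector space
topology for which the inclusion of each `C⋆`-subalgebra `D ⊆ Ped(A)` (that is, each norm-closed
`*`-subalgebra of `A` contained in `Ped(A)`, with its norm topology) is continuous. -/
noncomputable instance : TopologicalSpace (Ped A) :=
  sInf {t : TopologicalSpace (Ped A) |
    (∀ (D : NonUnitalStarSubalgebra ℂ A) (hD : D ≤ pedersenIdeal A), IsClosed (D : Set A) →
      @Continuous D (Ped A) _ t (incl D hD)) ∧
    @IsTopologicalAddGroup (Ped A) t _ ∧ @ContinuousSMul ℂ (Ped A) _ _ t ∧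
    @LocallyConvexSpace ℝ (Ped A) _ _ _ _ t}

instance : IsTopologicalAddGroup (Ped A) := topologicalAddGroup_sInf fun _ ht => ht.2.1
instance : ContinuousSMul ℂ (Ped A) := continuousSMul_sInf fun _ ht => ht.2.2.1
instance : LocallyConvexSpace ℝ (Ped A) := .sInf fun _ ht => ht.2.2.2

end Ped

end PedersenIdeal

section Traces

variable (A : Type*) [NonUnitalCStarAlgebra A] [PartialOrder A] [StarOrderedRing A]

/-- `T_ℝ(A)`: the real vector space of continuous self-adjoint traces `Ped(A) → ℂ`, with the
weak-⋆ topology (the topology of pointwise convergence on `Ped(A)`). -/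
def realTraces : Submodule ℝ (WeakDual ℂ (Ped A)) where
  carrier := {τ | (∀ x y : Ped A, τ (x * y) = τ (y * x)) ∧
    ∀ x : Ped A, τ (star x) = star (τ x)}
  add_mem' := fun {σ τ} hσ hτ =>
    ⟨fun x y => congrArg₂ (· + ·) (hσ.1 x y) (hτ.1 x y),
      fun x => (congrArg₂ (· + ·) (hσ.2 x) (hτ.2 x)).trans (star_add _ _).symm⟩
  zero_mem' := ⟨fun _ _ => rfl, fun _ => (star_zero ℂ).symm⟩
  smul_mem' := fun r τ hτ =>
    ⟨fun x y => congrArg (fun z : ℂ => (r : ℂ) • z) (hτ.1 x y), fun x => by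
      change (r : ℂ) • τ (star x) = star ((r : ℂ) • τ x)
      rw [hτ.2 x, star_smul]
      simp⟩

/-- `T_{≤ 1}(A)`: the contractive positive traces. -/
def contractivePositiveTraces : Set (realTraces A) :=
  {τ | (∀ a : Ped A, 0 ≤ a.val → 0 ≤ (τ.1 a).re) ∧ ∀ a : Ped A, ‖τ.1 a‖ ≤ ‖a.val‖}

/-- `T_ℝ(A)*`: the weak-⋆ continuous real linear functionals on `T_ℝ(A)`, with the topology of
uniform convergence on compact subsets of `T_ℝ(A)` (the compact-open topology). -/
abbrev TraceDual : Type _ := realTraces A →L_c[ℝ] ℝ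

instance : LocallyConvexSpace ℝ (TraceDual A) :=
  UniformConvergenceCLM.locallyConvexSpace ℝ {S : Set (realTraces A) | IsCompact S}
    ⟨∅, isCompact_empty⟩ (directedOn_of_sup_mem fun _ _ => IsCompact.union)

variable {A}

/-- The real number `τ(a)`, as a continuous real linear functional in `τ ∈ T_ℝ(A)`. -/
noncomputable def evalCLM (a : Ped A) : TraceDual A where
  toFun := fun τ => (τ.1 a).re
  map_add' := fun σ τ => Complex.add_re (σ.1 a) (τ.1 a)
  map_smul' := fun r τ => Complex.re_ofReal_mul r (τ.1 a)
  cont := Complex.continuous_re.comp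
    ((WeakDual.eval_continuous a).comp continuous_subtype_val)

/-- For self-adjoint `a`, the value `τ(a)` of a self-adjoint trace is real. -/
theorem coe_evalCLM (a : selfAdjoint (Ped A)) (τ : realTraces A) :
    ((evalCLM (a : Ped A) τ : ℝ) : ℂ) = τ.1 (a : Ped A) := by
  have h := τ.2.2 (a : Ped A)
  rw [show star (a : Ped A) = a from a.2] at h
  exact Complex.conj_eq_iff_re.1 h.symm

variable (A)

/-- The canonical linear map `Ped(A)_sa → T_ℝ(A)*`, `a ↦ â`, where `â(τ) = τ(a)`. Here `Ped(A)_sa`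
is the real subspace of self-adjoint elements of `Ped(A)`, with the subspace topology. -/
noncomputable def hat : selfAdjoint (Ped A) →ₗ[ℝ] TraceDual A where
  toFun := fun a => evalCLM (a : Ped A)
  map_add' := fun a b => by
    ext τ
    change (τ.1 ((a : Ped A) + b)).re = (τ.1 (a : Ped A)).re + (τ.1 (b : Ped A)).re
    rw [map_add, Complex.add_re]
  map_smul' := fun r a => by
    ext τ
    change (τ.1 ((r : ℂ) • (a : Ped A))).re = r * (τ.1 (a : Ped A)).re
    rw [map_smul, smul_eq_mul, Complex.re_ofReal_mul]

end Traces

end PedersenTrace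

/-! The quotient statement is a duality argument. Evaluations generate the weak-⋆ topology of
`T_ℝ(A)`, so every continuous functional is an evaluation. A compact set of traces is pointwise
bounded, hence uniformly bounded on each C⋆-subalgebra inside `Ped(A)` by Banach–Steinhaus; this
gives continuity. For openness, polars of neighbourhoods of zero are compact, and a Hahn–Banach
functional killing the kernel of `a ↦ â` is itself a trace (`exists_separating_trace`), so a bipolar
argument applies.

For the norm estimate, the same separation is applied to an open norm ball of radius `r`. If no
preimage of `f` had norm below `r`, there would be a norm-contractive self-adjoint trace with value
`r` at `a`. It extends to `A` and splits as `E - F` with positive traces whose norms sum to at most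
1 (`exists_trace_decomposition`), so its value at `a` is at most the supremum over `T_{≤1}(A)`.

The Jordan decomposition takes `E a` to be the supremum of `g` over `[0, a]`. Additivity cannot use
the Riesz decomposition property, which fails in noncommutative algebras. Instead, traciality gives
`g b ≈ g (a * d)` for `0 ≤ b ≤ a` with a positive contraction `d` (`exists_le_mul`), an expression
linear in `a`. -/

namespace PedersenTrace

/-! ### Jordan decomposition of bounded self-adjoint traces -/

section Decomposition

variable {A : Type*} [NonUnitalCStarAlgebra A] [PartialOrder A] [StarOrderedRing A]

/-- An approximate inverse square root of a positive element. -/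
theorem exists_approx_inv_sqrt {a : A} (ha : 0 ≤ a) {δ : ℝ} (hδ : 0 < δ) :
    ∃ c : A, IsSelfAdjoint c ∧ ‖c * a * c‖ ≤ 1 ∧
      ‖a - (c * a * c) * a - a * (c * a * c) + (c * a * c) * a * (c * a * c)‖ ≤ 2 * δ := by
  have hnn : ∀ t ∈ quasispectrum ℝ a, 0 ≤ t := fun t ht => quasispectrum_nonneg_of_nonneg a ha t ht
  -- A regularised `t ^ (-1/2)` that vanishes at 0, as the non-unital calculus requires. It makes `c
  -- * a * c` the function `k t = (t / (t + δ)) ^ 2`, and `t * (1 - k t) ^ 2 ≤ t * (1 - k t) ≤ 2 *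
  -- δ`.
  let h : ℝ → ℝ := fun t => √t / (t + δ)
  have hc : ContinuousOn h (quasispectrum ℝ a) :=
    ContinuousOn.div (by fun_prop) (by fun_prop) fun t ht => by have := hnn t ht; positivity
  have hid : cfcₙ (fun t : ℝ => t) a = a := cfcₙ_id' ℝ a
  let k : ℝ → ℝ := fun t => h t * t * h t
  have hk : cfcₙ h a * a * cfcₙ h a = cfcₙ k a := by
    have e : cfcₙ (fun t => h t * t) a = cfcₙ h a * a := by
      rw [cfcₙ_mul h (fun t => t) a, hid]
    rw [← e, ← cfcₙ_mul (fun t => h t * t) h a]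
  have hkc : ContinuousOn k (quasispectrum ℝ a) := (hc.mul continuousOn_id).mul hc
  have hkv : ∀ t, 0 ≤ t → k t = (t / (t + δ)) ^ 2 := fun t ht => by
    simp only [k, h]
    have : √t * √t = t := Real.mul_self_sqrt ht
    field_simp
    rw [sq, this, sq]
  refine ⟨cfcₙ h a, cfcₙ_predicate h a, ?_, ?_⟩
  · rw [hk]
    refine norm_cfcₙ_le fun t ht => ?_
    have := hnn t ht
    rw [hkv t this, Real.norm_of_nonneg (by positivity)]
    refine pow_le_one₀ (by positivity) ?_
    rw [div_le_one (by positivity)]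
    linarith
  · rw [hk]
    have e : a - cfcₙ k a * a - a * cfcₙ k a + cfcₙ k a * a * cfcₙ k a
        = cfcₙ (fun t => t - k t * t - t * k t + k t * t * k t) a := by
      have e1 : cfcₙ (fun t => k t * t) a = cfcₙ k a * a := by
        rw [cfcₙ_mul k (fun t => t) a, hid]
      have e2 : cfcₙ (fun t => t * k t) a = a * cfcₙ k a := by
        rw [cfcₙ_mul (fun t => t) k a, hid]
      have e3 : cfcₙ (fun t => k t * t * k t) a = cfcₙ k a * a * cfcₙ k a := by
        rw [cfcₙ_mul (fun t => k t * t) k a, e1]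
      rw [cfcₙ_add (a := a) (fun t => t - k t * t - t * k t) (fun t => k t * t * k t),
        cfcₙ_sub (a := a) (fun t => t - k t * t) (fun t => t * k t),
        cfcₙ_sub (a := a) (fun t => t) (fun t => k t * t), e1, e2, e3, hid]
    rw [e]
    refine norm_cfcₙ_le fun t ht => ?_
    have ht0 := hnn t ht
    have e : t - k t * t - t * k t + k t * t * k t = t * (1 - k t) ^ 2 := by ring
    have hk1 : 0 ≤ k t := by rw [hkv t ht0]; positivity
    rw [e, Real.norm_of_nonneg (by positivity)]
    have hle : k t ≤ 1 := by
      rw [hkv t ht0]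
      refine pow_le_one₀ (by positivity) ?_
      rw [div_le_one (by positivity)]
      linarith
    have h1 : t * (1 - k t) ≤ 2 * δ := by
      rw [hkv t ht0, div_pow, one_sub_div (by positivity), ← mul_div_assoc,
        div_le_iff₀ (by positivity)]
      nlinarith [mul_nonneg ht0 hδ.le, pow_pos hδ 3, mul_nonneg ht0 (sq_nonneg δ)]
    calc t * (1 - k t) ^ 2 = t * (1 - k t) * (1 - k t) := by ring
      _ ≤ t * (1 - k t) * 1 := by
        refine mul_le_mul_of_nonneg_left (by linarith) (mul_nonneg ht0 (by linarith))
      _ ≤ 2 * δ := by linarith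

theorem conj_le_of_norm_le_one {d : A} (hd : 0 ≤ d) (h1 : ‖d‖ ≤ 1) (x : A) :
    x * d * star x ≤ x * star x :=
  (CStarAlgebra.star_right_conjugate_le_norm_smul hd.isSelfAdjoint).trans <| by
    simpa using smul_le_smul_of_nonneg_right h1 (mul_star_self_nonneg x)

/-- Conjugating by `1 - k` in the unitization preserves positivity. -/
theorem one_sub_conj_nonneg {x k : A} (hx : 0 ≤ x) (hk : IsSelfAdjoint k) :
    0 ≤ x - k * x - x * k + k * x * k := by
  obtain ⟨s, rfl⟩ := CStarAlgebra.nonneg_iff_eq_star_mul_self.1 hx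
  have : star (s - s * k) * (s - s * k) =
      star s * s - k * (star s * s) - star s * s * k + k * (star s * s) * k := by
    simp only [star_sub, star_mul, hk.star_eq]
    noncomm_ring
  rw [← this]
  exact star_mul_self_nonneg _

/-- With `k = c * a * c`, the order `b ≤ a` gives `(1 - k) b (1 - k) ≤ (1 - k) a (1 - k)`, which is
small. So `k` is nearly a unit for `√b`, hence for `b`. -/
theorem exists_norm_sub_le {a b : A} (hb : 0 ≤ b) (hab : b ≤ a) {η : ℝ} (hη : 0 < η) :
    ∃ c : A, IsSelfAdjoint c ∧ 0 ≤ c * b * c ∧ ‖c * b * c‖ ≤ 1 ∧ ‖b - c * a * c * b‖ ≤ η := by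
  have ha := hb.trans hab
  set s := CFC.sqrt b
  have hs : star s = s := (CFC.sqrt_nonneg b).isSelfAdjoint
  have hss : s * s = b := CFC.sqrt_mul_sqrt_self b hb
  obtain ⟨δ, hδ, hδη⟩ : ∃ δ : ℝ, 0 < δ ∧ √(2 * δ) * ‖s‖ ≤ η := by
    refine ⟨(η / (‖s‖ + 1)) ^ 2 / 2, by positivity, ?_⟩
    rw [mul_div_cancel₀ _ two_ne_zero, Real.sqrt_sq (by positivity), div_mul_eq_mul_div,
      div_le_iff₀ (by positivity)]
    nlinarith [norm_nonneg s]
  obtain ⟨c, hc, hc1, hc2⟩ := exists_approx_inv_sqrt ha hδ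
  have hcc : ∀ {x : A}, 0 ≤ x → 0 ≤ c * x * c := fun hx => by
    simpa [hc.star_eq] using star_left_conjugate_nonneg hx c
  have hmono : c * b * c ≤ c * a * c := by
    simpa [hc.star_eq] using star_left_conjugate_le_conjugate hab c
  refine ⟨c, hc, hcc hb, ?_, ?_⟩
  · exact (CStarAlgebra.norm_le_norm_of_nonneg_of_le (hcc hb) hmono).trans hc1
  set k := c * a * c
  have hk : IsSelfAdjoint k := (hcc ha).isSelfAdjoint
  have e : (s - k * s) * star (s - k * s) = b - k * b - b * k + k * b * k := by
    simp only [star_sub, star_mul, hk.star_eq, hs, ← hss]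
    noncomm_ring
  have hle : b - k * b - b * k + k * b * k ≤ a - k * a - a * k + k * a * k := by
    rw [← sub_nonneg]
    have := one_sub_conj_nonneg (sub_nonneg.2 hab) hk
    convert this using 1
    noncomm_ring
  have hn : ‖s - k * s‖ ^ 2 ≤ 2 * δ := by
    rw [sq, ← CStarRing.norm_self_mul_star, e]
    exact (CStarAlgebra.norm_le_norm_of_nonneg_of_le (one_sub_conj_nonneg hb hk) hle).trans hc2
  have e2 : b - k * b = (s - k * s) * s := by rw [← hss]; noncomm_ring
  rw [e2]
  refine (norm_mul_le _ _).trans (le_trans ?_ hδη)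
  exact mul_le_mul_of_nonneg_right (Real.le_sqrt_of_sq_le hn) (norm_nonneg _)

/-- Both `x - y` and its negative lie below `x + y`, hence below `‖x + y‖` in the unitization, and
the norm of a self-adjoint element is attained on its spectrum up to sign. -/
theorem norm_sub_le_norm_add {x y : A} (hx : 0 ≤ x) (hy : 0 ≤ y) : ‖x - y‖ ≤ ‖x + y‖ := by
  have hsa : IsSelfAdjoint (x - y) := hx.isSelfAdjoint.sub hy.isSelfAdjoint
  have hw : IsSelfAdjoint (x + y) := hx.isSelfAdjoint.add hy.isSelfAdjoint
  have hle : ∀ z : A, IsSelfAdjoint z → z ≤ x + y →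
      (z : Unitization ℂ A) ≤ algebraMap ℝ _ ‖x + y‖ := fun z hz h => by
    have h1 := IsSelfAdjoint.le_algebraMap_norm_self (a := ((x + y : A) : Unitization ℂ A))
      (hw.inr ℂ)
    rw [Unitization.norm_inr] at h1
    exact ((Unitization.inr_le_iff z (x + y) hz hw).2 h).trans h1
  have h1 := hle (x - y) hsa (by rw [sub_eq_add_neg]; gcongr; exact (neg_nonpos.2 hy).trans hy)
  have h2 := hle (-(x - y)) hsa.neg (by
    rw [neg_sub, sub_eq_add_neg, add_comm]; gcongr; exact (neg_nonpos.2 hx).trans hx)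
  rw [le_algebraMap_iff_spectrum_le] at h1 h2
  rw [← Unitization.norm_inr (𝕜 := ℂ)]
  rcases CStarAlgebra.norm_or_neg_norm_mem_spectrum (a := ((x - y : A) : Unitization ℂ A))
    (hsa.inr ℂ) with h | h
  · exact h1 _ h
  · refine h2 _ ?_
    rw [Unitization.inr_neg, ← spectrum.neg_eq]
    exact h

/-- The supremum of `g` over the order interval from `0` to `a`. -/
noncomputable def supIcc (g : A → ℝ) (a : A) : ℝ := sSup (g '' Set.Icc 0 a)

/-- The real parts of self-adjoint traces: real linear, `*`-invariant, tracial functionals. -/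
def IsRealTrace (E : A →ₗ[ℝ] ℝ) : Prop :=
  (∀ x, E (star x) = E x) ∧ ∀ x y, E (x * y) = E (y * x)

variable {g : A →ₗ[ℝ] ℝ}

theorem le_supIcc (hb : ∀ x, |g x| ≤ ‖x‖) {a b : A} (h0 : 0 ≤ b) (hba : b ≤ a) :
    g b ≤ supIcc g a := by
  refine le_csSup ⟨‖a‖, ?_⟩ ⟨b, ⟨h0, hba⟩, rfl⟩
  rintro _ ⟨y, hy, rfl⟩
  exact (le_abs_self _).trans ((hb y).trans (CStarAlgebra.norm_le_norm_of_nonneg_of_le hy.1 hy.2))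

theorem supIcc_le {a : A} (ha : 0 ≤ a) {r : ℝ} (h : ∀ b, 0 ≤ b → b ≤ a → g b ≤ r) :
    supIcc g a ≤ r :=
  csSup_le ⟨_, 0, ⟨le_rfl, ha⟩, rfl⟩ (by rintro _ ⟨b, hb, rfl⟩; exact h b hb.1 hb.2)

theorem supIcc_nonneg (hb : ∀ x, |g x| ≤ ‖x‖) {a : A} (ha : 0 ≤ a) : 0 ≤ supIcc g a := by
  simpa using le_supIcc hb le_rfl ha

theorem supIcc_smul_le (hb : ∀ x, |g x| ≤ ‖x‖) {a : A} (ha : 0 ≤ a) {r : ℝ} (hr : 0 < r) :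
    supIcc g (r • a) ≤ r * supIcc g a := by
  refine supIcc_le (smul_nonneg hr.le ha) fun b h0 hba => ?_
  have h1 : r⁻¹ • b ≤ a := by
    have := smul_le_smul_of_nonneg_left hba (inv_nonneg.2 hr.le)
    rwa [smul_smul, inv_mul_cancel₀ hr.ne', one_smul] at this
  have := le_supIcc hb (smul_nonneg (inv_nonneg.2 hr.le) h0) h1
  rw [map_smul, smul_eq_mul, inv_mul_le_iff₀ hr] at this
  exact this

theorem supIcc_smul (hb : ∀ x, |g x| ≤ ‖x‖) {a : A} (ha : 0 ≤ a) {r : ℝ} (hr : 0 ≤ r) :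
    supIcc g (r • a) = r * supIcc g a := by
  rcases hr.eq_or_lt with rfl | hr
  · simp [supIcc]
  refine le_antisymm (supIcc_smul_le hb ha hr) ?_
  have := supIcc_smul_le hb (smul_nonneg hr.le ha) (inv_pos.2 hr)
  rwa [smul_smul, inv_mul_cancel₀ hr.ne', one_smul, ← div_eq_inv_mul, le_div_iff₀' hr] at this

/-- The substitute for Riesz decomposition: `b ≈ c * a * c * b`, and traciality turns this into `a *
d` with `d = c * b * c`. -/
theorem exists_le_mul (hb : ∀ x, |g x| ≤ ‖x‖) (ht : ∀ x y, g (x * y) = g (y * x)) {a b : A}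
    (h0 : 0 ≤ b) (hba : b ≤ a) {η : ℝ} (hη : 0 < η) :
    ∃ d : A, 0 ≤ d ∧ ‖d‖ ≤ 1 ∧ g b ≤ g (a * d) + η := by
  obtain ⟨c, -, h1, h2, h3⟩ := exists_norm_sub_le h0 hba hη
  refine ⟨c * b * c, h1, h2, ?_⟩
  have e : g (a * (c * b * c)) = g (c * a * c * b) := by
    rw [← mul_assoc, ht]; simp only [mul_assoc]
  have := (le_abs_self _).trans ((hb _).trans h3)
  rw [map_sub] at this
  linarith

/-- Traciality moves `star x * (x * d)` to `x * d * star x`, which lies between 0 and `x * star x`.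
Taking `x = √a` bounds `g (a * d)`; general `x` yields traciality of the supremum. -/
theorem le_supIcc_conj (hb : ∀ x, |g x| ≤ ‖x‖) (ht : ∀ x y, g (x * y) = g (y * x)) {d : A}
    (hd : 0 ≤ d) (h1 : ‖d‖ ≤ 1) (x : A) : g (star x * x * d) ≤ supIcc g (x * star x) := by
  rw [mul_assoc, ht]
  exact le_supIcc hb (star_right_conjugate_nonneg hd x) (conj_le_of_norm_le_one hd h1 x)

theorem le_supIcc_mul (hb : ∀ x, |g x| ≤ ‖x‖) (ht : ∀ x y, g (x * y) = g (y * x)) {a d : A}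
    (ha : 0 ≤ a) (hd : 0 ≤ d) (h1 : ‖d‖ ≤ 1) : g (a * d) ≤ supIcc g a := by
  have hs : star (CFC.sqrt a) = CFC.sqrt a := (CFC.sqrt_nonneg a).isSelfAdjoint
  have hss : CFC.sqrt a * CFC.sqrt a = a := CFC.sqrt_mul_sqrt_self a ha
  have := le_supIcc_conj hb ht hd h1 (CFC.sqrt a)
  rwa [hs, hss] at this

theorem supIcc_add (hb : ∀ x, |g x| ≤ ‖x‖) (ht : ∀ x y, g (x * y) = g (y * x)) {a b : A}
    (ha : 0 ≤ a) (hb0 : 0 ≤ b) : supIcc g (a + b) = supIcc g a + supIcc g b := by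
  apply le_antisymm
  · refine supIcc_le (add_nonneg ha hb0) fun x h0 hx => ?_
    refine le_of_forall_pos_le_add fun η hη => ?_
    obtain ⟨d, hd, h1, h⟩ := exists_le_mul hb ht h0 hx hη
    rw [add_mul, map_add] at h
    linarith [le_supIcc_mul hb ht ha hd h1, le_supIcc_mul hb ht hb0 hd h1]
  · rw [← le_sub_iff_add_le]
    refine supIcc_le ha fun x h0 hx => ?_
    rw [le_sub_iff_add_le, ← le_sub_iff_add_le']
    refine supIcc_le hb0 fun y h0y hy => ?_
    rw [le_sub_iff_add_le', ← map_add]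
    exact le_supIcc hb (add_nonneg h0 h0y) (add_le_add hx hy)

theorem supIcc_star_mul_self_le (hb : ∀ x, |g x| ≤ ‖x‖) (ht : ∀ x y, g (x * y) = g (y * x))
    (x : A) : supIcc g (star x * x) ≤ supIcc g (x * star x) := by
  refine supIcc_le (star_mul_self_nonneg x) fun y h0 hy => ?_
  refine le_of_forall_pos_le_add fun η hη => ?_
  obtain ⟨d, hd, h1, h⟩ := exists_le_mul hb ht h0 hy hη
  linarith [le_supIcc_conj hb ht hd h1 x]

/-- An additive, positively homogeneous, tracial function on the positive cone extends to a
real linear trace. -/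
theorem exists_isRealTrace_of_cone {P : A → ℝ} (hadd : ∀ a b, 0 ≤ a → 0 ≤ b → P (a + b) = P a + P b)
    (hsmul : ∀ (r : ℝ) a, 0 ≤ r → 0 ≤ a → P (r • a) = r * P a)
    (htr : ∀ x, P (star x * x) = P (x * star x)) :
    ∃ E : A →ₗ[ℝ] ℝ, IsRealTrace E ∧ ∀ a, 0 ≤ a → E a = P a := by
  have hsplit : ∀ x : A, (realPart x : A) = (realPart x : A)⁺ - (realPart x : A)⁻ := fun x =>
    (CFC.posPart_sub_negPart _ (realPart x).2).symm
  -- Additivity makes the value independent of how the real part is written as a difference of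
  -- positive elements; linearity follows by choosing suitable differences.
  have key : ∀ x p q : A, 0 ≤ p → 0 ≤ q → (realPart x : A) = p - q →
      P (realPart x : A)⁺ - P (realPart x : A)⁻ = P p - P q := by
    intro x p q hp hq h
    rw [hsplit x, sub_eq_sub_iff_add_eq_add] at h
    have := congrArg P h
    rw [hadd _ _ (CFC.posPart_nonneg _) hq, hadd _ _ hp (CFC.negPart_nonneg _)] at this
    linarith
  have hP0 : P 0 = 0 := by simpa using hsmul 0 0 le_rfl le_rfl
  let E : A →ₗ[ℝ] ℝ :=
    { toFun := fun x => P (realPart x : A)⁺ - P (realPart x : A)⁻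
      map_add' := fun x y => by
        rw [key (x + y) ((realPart x : A)⁺ + (realPart y : A)⁺)
          ((realPart x : A)⁻ + (realPart y : A)⁻)
          (add_nonneg (CFC.posPart_nonneg _) (CFC.posPart_nonneg _))
          (add_nonneg (CFC.negPart_nonneg _) (CFC.negPart_nonneg _)),
          hadd _ _ (CFC.posPart_nonneg _) (CFC.posPart_nonneg _),
          hadd _ _ (CFC.negPart_nonneg _) (CFC.negPart_nonneg _)]
        · ring
        · rw [map_add, AddSubgroup.coe_add, add_sub_add_comm, ← hsplit, ← hsplit]
      map_smul' := fun r x => by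
        rw [RingHom.id_apply, smul_eq_mul]
        have hp := CFC.posPart_nonneg (realPart x : A)
        have hn := CFC.negPart_nonneg (realPart x : A)
        rcases le_total 0 r with hr | hr
        · rw [key (r • x) (r • (realPart x : A)⁺) (r • (realPart x : A)⁻)
            (smul_nonneg hr hp) (smul_nonneg hr hn), hsmul _ _ hr hp, hsmul _ _ hr hn]
          · ring
          · rw [map_smul, selfAdjoint.val_smul, ← smul_sub, ← hsplit]
        · have hr' : 0 ≤ -r := neg_nonneg.2 hr
          rw [key (r • x) ((-r) • (realPart x : A)⁻) ((-r) • (realPart x : A)⁺)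
            (smul_nonneg hr' hn) (smul_nonneg hr' hp), hsmul _ _ hr' hp, hsmul _ _ hr' hn]
          · ring
          · rw [map_smul, selfAdjoint.val_smul, ← smul_sub, neg_smul, ← smul_neg, neg_sub,
              ← hsplit] }
  have hE : ∀ x p q : A, 0 ≤ p → 0 ≤ q → (realPart x : A) = p - q → E x = P p - P q := key
  have hEpos : ∀ a, 0 ≤ a → E a = P a := fun a ha => by
    rw [hE a a 0 ha le_rfl (by rw [sub_zero, ha.isSelfAdjoint.coe_realPart]), hP0, sub_zero]
  have hEstar : ∀ x, E (star x) = E x := fun x =>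
    hE (star x) _ _ (CFC.posPart_nonneg _) (CFC.negPart_nonneg _) (by
      rw [← hsplit, realPart_apply_coe, realPart_apply_coe, star_star, add_comm])
  refine ⟨E, ⟨hEstar, fun x y => ?_⟩, hEpos⟩
  have hsq : ∀ z, E (star z * z) = E (z * star z) := fun z => by
    rw [hEpos _ (star_mul_self_nonneg z), hEpos _ (mul_star_self_nonneg z), htr]
  -- Polarization: the cross terms are `E (star x * star y) + E (y * x)` and `E (x * y) + E (star y
  -- * star x)`, which are `2 * E (y * x)` and `2 * E (x * y)` by ⋆-invariance.
  have h := hsq (x + star y)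
  simp only [star_add, star_star, add_mul, mul_add, map_add, hsq x] at h
  have h2 := hsq y
  have h3 : E (star x * star y) = E (y * x) := by rw [← star_mul, hEstar]
  have h4 : E (star y * star x) = E (x * y) := by rw [← star_mul, hEstar]
  linarith

theorem le_mul_norm_of_forall_ball {E : A →ₗ[ℝ] ℝ} (hE : IsRealTrace E)
    (hpos : ∀ a, 0 ≤ a → 0 ≤ E a) {c : ℝ} (hc : 0 ≤ c)
    (h : ∀ e, 0 ≤ e → ‖e‖ < 1 → E e ≤ c) (x : A) : |E x| ≤ c * ‖x‖ := by
  have h1 : ∀ a, 0 ≤ a → E a ≤ c * ‖a‖ := by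
    intro a ha
    refine le_of_forall_pos_le_add fun ε hε => ?_
    -- Strictly above `‖a‖`, so that `a / t` is in the open ball, while `c * t ≤ c * ‖a‖ + ε` even
    -- for `c = 0`.
    set t := ‖a‖ + ε / (c + 1)
    have ht : ‖a‖ < t := lt_add_of_pos_right _ (by positivity)
    have ht0 : 0 < t := (norm_nonneg a).trans_lt ht
    have := h (t⁻¹ • a) (smul_nonneg (inv_nonneg.2 ht0.le) ha) (by
      rw [norm_smul, norm_inv, Real.norm_of_nonneg ht0.le, inv_mul_lt_iff₀ ht0, mul_one]
      exact ht)
    rw [map_smul, smul_eq_mul, inv_mul_le_iff₀ ht0] at this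
    refine this.trans ?_
    have : c * (ε / (c + 1)) ≤ ε := by
      rw [← mul_div_assoc, div_le_iff₀ (by positivity)]; nlinarith
    simp only [t]
    linarith
  have h2 : ∀ x : A, IsSelfAdjoint x → E x ≤ c * ‖x‖ := by
    intro x hx
    have e := CFC.posPart_sub_negPart x hx
    calc E x = E x⁺ - E x⁻ := by rw [← map_sub, e]
      _ ≤ E x⁺ := by linarith [hpos _ (CFC.negPart_nonneg x)]
      _ ≤ c * ‖x⁺‖ := h1 _ (CFC.posPart_nonneg x)
      _ ≤ c * ‖x‖ := mul_le_mul_of_nonneg_left (CStarAlgebra.norm_posPart_le x) hc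
  have h3 : ∀ x : A, E x ≤ c * ‖x‖ := by
    intro x
    have e : E x = E (realPart x : A) := by
      rw [realPart_apply_coe, map_smul, map_add, hE.1, smul_eq_mul]; norm_num; ring
    rw [e]
    exact (h2 _ (realPart x).2).trans (mul_le_mul_of_nonneg_left (realPart.norm_le x) hc)
  rw [abs_le']
  refine ⟨h3 x, ?_⟩
  simpa using h3 (-x)

/-- Jordan decomposition of a bounded self-adjoint trace. -/
theorem exists_trace_decomposition (hg : IsRealTrace g) (hb : ∀ x, |g x| ≤ ‖x‖) :
    ∃ (E F : A →ₗ[ℝ] ℝ) (c d : ℝ), g = E - F ∧ 0 ≤ c ∧ 0 ≤ d ∧ c + d ≤ 1 ∧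
      IsRealTrace E ∧ IsRealTrace F ∧ (∀ a, 0 ≤ a → 0 ≤ E a) ∧ (∀ a, 0 ≤ a → 0 ≤ F a) ∧
      (∀ x, |E x| ≤ c * ‖x‖) ∧ ∀ x, |F x| ≤ d * ‖x‖ := by
  obtain ⟨E, hE, hEP⟩ := exists_isRealTrace_of_cone (P := supIcc g)
    (fun a b ha hb0 => supIcc_add hb hg.2 ha hb0) (fun r a hr ha => supIcc_smul hb ha hr)
    (fun x => le_antisymm (supIcc_star_mul_self_le hb hg.2 x)
      (by simpa using supIcc_star_mul_self_le hb hg.2 (star x)))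
  have hE0 : ∀ a, 0 ≤ a → 0 ≤ E a := fun a ha => by rw [hEP a ha]; exact supIcc_nonneg hb ha
  have hF : IsRealTrace (E - g) :=
    ⟨fun x => by simp [hE.1, hg.1], fun x y => by simp [hE.2 x y, hg.2 x y]⟩
  have hF0 : ∀ a, 0 ≤ a → 0 ≤ (E - g) a := fun a ha => by
    rw [LinearMap.sub_apply, hEP a ha, sub_nonneg]; exact le_supIcc hb ha le_rfl
  have mono : ∀ {G : A →ₗ[ℝ] ℝ}, (∀ a, 0 ≤ a → 0 ≤ G a) → ∀ {x y}, x ≤ y → G x ≤ G y := by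
    intro G hG x y hxy
    have := hG _ (sub_nonneg.2 hxy)
    rw [map_sub] at this
    linarith
  -- The two norms are suprema over unrelated `e` and `e'`. The open positive ball is upward
  -- directed, so a common bound `u` reduces the sum to `2 * E u - g u`.
  have hsum : ∀ e e' : A, 0 ≤ e → ‖e‖ < 1 → 0 ≤ e' → ‖e'‖ < 1 → E e + (E - g) e' ≤ 1 := by
    intro e e' he he1 he' he1'
    obtain ⟨u, ⟨hu, hu1⟩, heu, heu'⟩ := CStarAlgebra.directedOn_nonneg_ball (A := A) e
      ⟨he, by simpa using he1⟩ e' ⟨he', by simpa using he1'⟩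
    have hu0 : 0 ≤ u := hu
    have hu1' : ‖u‖ ≤ 1 := by simpa using (Metric.mem_ball.1 hu1).le
    refine (add_le_add (mono hE0 heu) (mono hF0 heu')).trans ?_
    rw [LinearMap.sub_apply]
    have : E u ≤ (1 + g u) / 2 := by
      rw [hEP u hu0]
      refine supIcc_le hu0 fun b h0 hbu => ?_
      -- This reads `2 * g b - g u ≤ 1`; the supremum over `b` then bounds `2 * E u - g u`.
      have h1 : g (b - (u - b)) ≤ 1 := by
        refine (le_abs_self _).trans ((hb _).trans (le_trans ?_ hu1'))
        simpa using norm_sub_le_norm_add h0 (sub_nonneg.2 hbu)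
      rw [map_sub, map_sub] at h1
      linarith
    linarith
  let B : Set A := {e | 0 ≤ e ∧ ‖e‖ < 1}
  have h0B : (0 : A) ∈ B := ⟨le_rfl, by simp⟩
  have hEbdd : BddAbove (E '' B) := ⟨1, by
    rintro _ ⟨e, he, rfl⟩; simpa using hsum e 0 he.1 he.2 le_rfl (by simp)⟩
  have hFbdd : BddAbove ((E - g) '' B) := ⟨1, by
    rintro _ ⟨e, he, rfl⟩; simpa using hsum 0 e le_rfl (by simp) he.1 he.2⟩
  have hc : 0 ≤ sSup (E '' B) := le_csSup hEbdd ⟨0, h0B, map_zero _⟩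
  have hd : 0 ≤ sSup ((E - g) '' B) := le_csSup hFbdd ⟨0, h0B, map_zero _⟩
  refine ⟨E, E - g, sSup (E '' B), sSup ((E - g) '' B), by simp, hc, hd, ?_, hE, hF, hE0, hF0,
    le_mul_norm_of_forall_ball hE hE0 hc fun e he h1 => le_csSup hEbdd ⟨e, ⟨he, h1⟩, rfl⟩,
    le_mul_norm_of_forall_ball hF hF0 hd fun e he h1 => le_csSup hFbdd ⟨e, ⟨he, h1⟩, rfl⟩⟩
  rw [← le_sub_iff_add_le]
  refine csSup_le ⟨_, 0, h0B, rfl⟩ ?_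
  rintro _ ⟨e, he, rfl⟩
  rw [le_sub_iff_add_le, ← le_sub_iff_add_le']
  refine csSup_le ⟨_, 0, h0B, rfl⟩ ?_
  rintro _ ⟨e', he', rfl⟩
  rw [le_sub_iff_add_le']
  exact hsum e e' he.1 he.2 he'.1 he'.2

end Decomposition
-- The inductive limit topology and separation by traces
section Topology

open Topology
open scoped Pointwise

variable {A : Type*} [NonUnitalCStarAlgebra A] [PartialOrder A] [StarOrderedRing A]

namespace Ped

instance : IsScalarTower ℂ (Ped A) (Ped A) :=
  inferInstanceAs (IsScalarTower ℂ ↥(pedersenIdeal A) ↥(pedersenIdeal A))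

instance : SMulCommClass ℂ (Ped A) (Ped A) :=
  inferInstanceAs (SMulCommClass ℂ ↥(pedersenIdeal A) ↥(pedersenIdeal A))

instance : ContinuousSMul ℝ (Ped A) := IsScalarTower.continuousSMul ℂ

theorem continuous_incl (D : NonUnitalStarSubalgebra ℂ A) (hD : D ≤ pedersenIdeal A)
    (hc : IsClosed (D : Set A)) : Continuous (incl D hD) :=
  continuous_sInf_rng.2 fun _ ht => ht.1 D hD hc

/-- The universal property of the inductive limit topology; `f` is the identity for linear and the
conjugation for antilinear maps. -/
theorem continuous_of_forall_incl {F : Type*} [AddCommGroup F] [Module ℂ F] [TopologicalSpace F]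
    [IsTopologicalAddGroup F] [ContinuousSMul ℂ F] [LocallyConvexSpace ℝ F]
    (L : Ped A →ₗ[ℝ] F) {f : ℂ → ℂ} (hf : Continuous f) (hL : ∀ (c : ℂ) x, L (c • x) = f c • L x)
    (h : ∀ (D : NonUnitalStarSubalgebra ℂ A) (hD : D ≤ pedersenIdeal A), IsClosed (D : Set A) →
      Continuous fun d => L (incl D hD d)) : Continuous L := by
  rw [continuous_iff_le_induced]
  refine sInf_le ⟨fun D hD hc => continuous_induced_rng.2 (h D hD hc),
    topologicalAddGroup_induced L, ?_, LocallyConvexSpace.induced L⟩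
  let _ : TopologicalSpace (Ped A) := .induced L inferInstance
  exact Topology.IsInducing.continuousSMul (g := L) (f := f) ⟨rfl⟩ hf fun {c x} => hL c x

variable (A) in
/-- The inclusion `Ped(A) → A` as a linear map. -/
def valₗ : Ped A →ₗ[ℂ] A where
  toFun := val
  map_add' _ _ := rfl
  map_smul' _ _ := rfl

theorem val_mul (x y : Ped A) : (x * y).val = x.val * y.val := rfl

theorem val_star (x : Ped A) : (star x).val = star x.val := rfl

theorem continuous_val : Continuous (val : Ped A → A) :=
  continuous_of_forall_incl ((valₗ A).restrictScalars ℝ) continuous_id (fun _ _ => rfl)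
    fun _ _ _ => continuous_subtype_val

instance : ContinuousStar (Ped A) where
  continuous_star := by
    let L : Ped A →ₗ[ℝ] Ped A :=
      { toFun := star
        map_add' := star_add
        map_smul' := fun r x => by simp }
    refine continuous_of_forall_incl L Complex.continuous_conj (fun c x => star_smul c x)
      fun D hD hc => ?_
    have : (fun d => L (incl D hD d)) = fun d => incl D hD (star d) := rfl
    rw [this]
    refine (continuous_incl D hD hc).comp (Continuous.subtype_mk ?_ _)
    exact continuous_star.comp continuous_subtype_val

theorem continuous_realPart : Continuous (realPart : Ped A → selfAdjoint (Ped A)) := by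
  refine Continuous.subtype_mk ?_ _
  exact (continuous_id.add continuous_star).const_smul (2⁻¹ : ℝ)

end Ped

/-- A self-adjoint trace takes conjugate values at `x` and `star x`. Hence `a ↦ â` can be studied on
all of `Ped(A)`, where the universal property is available. -/
theorem evalCLM_realPart (x : Ped A) : evalCLM (realPart x : Ped A) = evalCLM x := by
  ext τ
  change (τ.1 (realPart x : Ped A)).re = (τ.1 x).re
  have h : τ.1 (realPart x : Ped A) = (2⁻¹ : ℂ) * (τ.1 x + star (τ.1 x)) := by
    rw [realPart_apply_coe, ← τ.2.2 x, ← map_add, ← smul_eq_mul, ← map_smul]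
    congr 1
    rw [← Complex.coe_smul]
    simp
  rw [h]
  simp
  ring

/-- The map `a ↦ â` on all of `Ped(A)`. -/
noncomputable def evalₗ (A : Type*) [NonUnitalCStarAlgebra A] [PartialOrder A] [StarOrderedRing A] :
    Ped A →ₗ[ℝ] TraceDual A :=
  hat A ∘ₗ realPart

theorem evalₗ_apply (x : Ped A) (τ : realTraces A) : evalₗ A x τ = (τ.1 x).re :=
  DFunLike.congr_fun (evalCLM_realPart x) τ

/-- Self-adjoint traces on `Ped(A)` are determined by, and can be constructed from, their real
parts. -/
theorem exists_realTraces_re_eq (G : StrongDual ℝ (Ped A)) (hs : ∀ x, G (star x) = G x)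
    (ht : ∀ x y, G (x * y) = G (y * x)) : ∃ τ : realTraces A, ∀ x, (τ.1 x).re = G x := by
  let T : StrongDual ℂ (Ped A) := G.extendRCLike
  have hT : ∀ x, T x = (G x : ℂ) - Complex.I * (G (Complex.I • x) : ℂ) :=
    fun x => G.extendRCLike_apply x
  refine ⟨⟨StrongDual.toWeakDual T, fun x y => ?_, fun x => ?_⟩, fun x => ?_⟩
  · change T (x * y) = T (y * x)
    have h : G (Complex.I • (x * y)) = G (Complex.I • (y * x)) := by
      rw [← smul_mul_assoc, ht, mul_smul_comm]
    rw [hT, hT, ht, h]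
  · change T (star x) = star (T x)
    have h : G (Complex.I • star x) = - G (Complex.I • x) := by
      rw [← hs (Complex.I • x), star_smul, Complex.star_def, Complex.conj_I, neg_smul, map_neg,
        neg_neg]
    rw [hT, hT, hs, h]
    simp
  · change (T x).re = G x
    rw [hT]
    simp

/-- Hahn–Banach separates `a` from `V + N`, with `N` the kernel of `evalₗ`. The functional must
vanish on `N`, which contains all `x * y - y * x` and `star x - x`, so it is the real part of a
self-adjoint trace. -/
theorem exists_separating_trace {V : Set (Ped A)} (hV : IsOpen V) (hc : Convex ℝ V)
    (hne : V.Nonempty) {a : Ped A} (ha : ∀ v ∈ V, evalₗ A v ≠ evalₗ A a) :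
    ∃ τ : realTraces A, ∀ v ∈ V, (τ.1 v).re < (τ.1 a).re := by
  let N : Submodule ℝ (Ped A) := LinearMap.ker (evalₗ A)
  have hW : IsOpen (V + (N : Set (Ped A))) := hV.add_right
  have haW : a ∉ V + (N : Set (Ped A)) := by
    rintro ⟨v, hv, n, hn, rfl⟩
    refine ha v hv ?_
    rw [map_add, LinearMap.mem_ker.1 hn, add_zero]
  obtain ⟨G, hG⟩ := geometric_hahn_banach_open_point (hc.add N.convex) hW haW
  obtain ⟨v₀, hv₀⟩ := hne
  have hGN : ∀ n ∈ N, G n = 0 := by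
    intro n hn
    by_contra h
    -- The multiple of `n` is chosen so that `G` takes the value `G a` at a point of `V + N`.
    have := hG _ ⟨v₀, hv₀, ((G a - G v₀) / G n) • n, N.smul_mem _ hn, rfl⟩
    rw [map_add, map_smul, smul_eq_mul, div_mul_cancel₀ _ h] at this
    linarith
  have hker : ∀ x y : Ped A, (∀ τ : realTraces A, (τ.1 x).re = (τ.1 y).re) → G x = G y := by
    intro x y h
    rw [← sub_eq_zero, ← map_sub]
    refine hGN _ (LinearMap.mem_ker.2 ?_)
    rw [map_sub, sub_eq_zero]
    ext τ
    rw [evalₗ_apply, evalₗ_apply, h]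
  obtain ⟨τ, hτ⟩ := exists_realTraces_re_eq G
    (fun x => hker _ _ fun τ => by rw [τ.2.2 x]; exact Complex.conj_re _)
    (fun x y => hker _ _ fun τ => by rw [τ.2.1 x y])
  refine ⟨τ, fun v hv => ?_⟩
  rw [hτ, hτ]
  exact hG v ⟨v, hv, 0, N.zero_mem, add_zero v⟩

end Topology
-- The quotient map
section Quotient

open Topology
open scoped Pointwise

variable {A : Type*} [NonUnitalCStarAlgebra A] [PartialOrder A] [StarOrderedRing A]

/-- Real parts suffice because the imaginary part of `τ x` is minus the real part of `τ (i x)`. -/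
theorem isInducing_re :
    IsInducing fun (τ : realTraces A) (x : Ped A) => (τ.1 x).re := by
  have h1 : IsInducing fun (τ : realTraces A) (x : Ped A) => τ.1 x :=
    IsInducing.comp (g := fun (f : WeakDual ℂ (Ped A)) x => f x) ⟨rfl⟩ IsInducing.subtypeVal
  have hφ : Continuous fun (G : Ped A → ℝ) (x : Ped A) =>
      (G x : ℂ) - Complex.I * (G (Complex.I • x) : ℂ) := by fun_prop
  refine IsInducing.of_comp (continuous_pi fun x => Complex.continuous_re.comp
    ((WeakDual.eval_continuous x).comp continuous_subtype_val)) hφ ?_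
  convert h1 using 1
  ext τ x
  have h : τ.1 (Complex.I • x) = Complex.I * τ.1 x := map_smul τ.1 _ x
  simp only [Function.comp_apply, h]
  apply Complex.ext <;> simp

/-- For compact `K`, evaluation into `C(K, ℂ)` need only be continuous on each closed `D`. There
Banach–Steinhaus applies: `D` is complete, and `K` is pointwise bounded by compactness. -/
theorem continuous_evalₗ : Continuous (evalₗ A) := by
  refine continuous_of_continuousAt_zero _ ?_
  rw [ContinuousAt, map_zero, CompactConvergenceCLM.hasBasis_nhds_zero.tendsto_right_iff]
  rintro ⟨K, V⟩ ⟨hK, hV⟩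
  have hK : IsCompact K := hK
  have := isCompact_iff_compactSpace.1 hK
  let L : Ped A →ₗ[ℂ] C(K, ℂ) :=
    { toFun := fun a => ⟨fun τ => τ.1.1 a, (WeakDual.eval_continuous a).comp
        (continuous_subtype_val.comp continuous_subtype_val)⟩
      map_add' := fun a b => by ext τ; exact map_add τ.1.1 a b
      map_smul' := fun c a => by ext τ; exact map_smul τ.1.1 c a }
  have hL : Continuous L := by
    refine Ped.continuous_of_forall_incl (L.restrictScalars ℝ) continuous_id
      (fun c x => map_smul L c x) fun D hD hc => ?_
    let S : Submodule ℂ A := D.toSubmodule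
    have : CompleteSpace S := IsClosed.completeSpace_coe (s := (D : Set A)) (hs := hc)
    let j : S →ₗ[ℂ] Ped A :=
      { toFun := fun d => Ped.incl D hD d
        map_add' := fun _ _ => rfl
        map_smul' := fun _ _ => rfl }
    have hj : Continuous j := Ped.continuous_incl D hD hc
    let g : K → S →L[ℂ] ℂ := fun τ => ⟨τ.1.1.toLinearMap ∘ₗ j, τ.1.1.continuous.comp hj⟩
    obtain ⟨C, hC⟩ := banach_steinhaus (g := g) fun d => ⟨‖L (j d)‖, fun τ =>
      (L (j d)).norm_coe_le_norm τ⟩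
    exact (LinearMap.mkContinuous (L ∘ₗ j) (max C 0) fun d =>
      (ContinuousMap.norm_le _ (by positivity)).2 fun τ =>
        ((g τ).le_opNorm d).trans (mul_le_mul_of_nonneg_right ((hC τ).trans (le_max_left _ _))
          (norm_nonneg d))).continuous
  obtain ⟨δ, hδ, hδV⟩ := Metric.mem_nhds_iff.1 hV
  have h0 : ∀ᶠ a in 𝓝 (0 : Ped A), ‖L a‖ < δ := by
    exact hL.norm.tendsto 0 (Iio_mem_nhds (by simpa using hδ))
  filter_upwards [h0] with a ha τ hτ
  refine hδV ?_
  rw [mem_ball_zero_iff, evalₗ_apply]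
  exact (Complex.abs_re_le_norm _).trans_lt (((L a).norm_coe_le_norm ⟨τ, hτ⟩).trans_lt ha)

/-- If the topology of `X` is induced by the functionals `L x`, these are all the continuous
functionals on `X`. -/
theorem surjective_of_isInducing {X P : Type*} [AddCommGroup X] [Module ℝ X] [TopologicalSpace X]
    [AddCommGroup P] [Module ℝ P] (L : P →ₗ[ℝ] (X →L_c[ℝ] ℝ))
    (h : IsInducing fun (τ : X) (x : P) => L x τ) : Function.Surjective L := by
  intro f
  let ev : P →ₗ[ℝ] X →ₗ[ℝ] ℝ :=
    { toFun := fun x => ContinuousLinearMap.toLinearMap (L x)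
      map_add' := fun x y => by ext τ; exact DFunLike.congr_fun (map_add L x y) τ
      map_smul' := fun r x => by ext τ; exact DFunLike.congr_fun (map_smul L r x) τ }
  have hspan : ContinuousLinearMap.toLinearMap f ∈ Submodule.span ℝ (Set.range ev) := by
    -- A functional continuous for the topology induced by a family of functionals is a finite
    -- linear combination of them; here the family is already a subspace.
    rw [LinearMap.mem_span_iff_continuous]
    have ht := h.eq_induced
    rw [induced_to_pi] at ht
    have hf : Continuous (ContinuousLinearMap.toLinearMap f) := f.cont
    exact continuous_iff_le_induced.2 (ht.ge.trans hf.le_induced)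
  rw [← LinearMap.coe_range, Submodule.span_eq] at hspan
  obtain ⟨x, hx⟩ := hspan
  exact ⟨x, by ext τ; exact DFunLike.congr_fun hx τ⟩

theorem surjective_evalₗ : Function.Surjective (evalₗ A) := by
  refine surjective_of_isInducing (evalₗ A) ?_
  simp only [evalₗ_apply]
  exact isInducing_re

/-- A Banach–Alaoglu theorem for polars of neighbourhoods of zero in `Ped(A)`. -/
theorem isCompact_polar {V : Set (Ped A)} (hV : V ∈ 𝓝 0) :
    IsCompact {τ : realTraces A | ∀ v ∈ V, |(τ.1 v).re| ≤ 1} := by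
  have habs : ∀ x : Ped A, ∃ t : ℝ, 0 < t ∧ t • x ∈ V := by
    intro x
    have h : Filter.Tendsto (fun t : ℝ => t • x) (𝓝 0) (𝓝 0) := by
      have hc : Continuous fun t : ℝ => t • x := by fun_prop
      simpa using hc.tendsto 0
    obtain ⟨ε, hε, h⟩ := Metric.mem_nhds_iff.1 (h hV)
    exact ⟨ε / 2, by positivity, h (by rw [mem_ball_zero_iff, Real.norm_of_nonneg] <;> linarith)⟩
  choose t ht htV using habs
  -- Only pointwise closed conditions appear. Continuity need not be imposed, since it follows from
  -- the bound on `V`; pointwise boundedness follows because `V` is absorbing.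
  let S : Set (Ped A → ℝ) := {G | (∀ x y, G (x + y) = G x + G y) ∧
    (∀ (r : ℝ) x, G (r • x) = r * G x) ∧ (∀ x, G (star x) = G x) ∧
    (∀ x y, G (x * y) = G (y * x)) ∧ ∀ v ∈ V, |G v| ≤ 1}
  have hS : IsClosed S := by
    have h1 : IsClosed {G : Ped A → ℝ | ∀ x y, G (x + y) = G x + G y} := by
      simp only [Set.ofPred_forall]
      exact isClosed_iInter fun x => isClosed_iInter fun y => isClosed_eq (by fun_prop) (by fun_prop)
    have h2 : IsClosed {G : Ped A → ℝ | ∀ (r : ℝ) x, G (r • x) = r * G x} := by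
      simp only [Set.ofPred_forall]
      exact isClosed_iInter fun x => isClosed_iInter fun y => isClosed_eq (by fun_prop) (by fun_prop)
    have h3 : IsClosed {G : Ped A → ℝ | ∀ x, G (star x) = G x} := by
      simp only [Set.ofPred_forall]
      exact isClosed_iInter fun x => isClosed_eq (by fun_prop) (by fun_prop)
    have h4 : IsClosed {G : Ped A → ℝ | ∀ x y, G (x * y) = G (y * x)} := by
      simp only [Set.ofPred_forall]
      exact isClosed_iInter fun x => isClosed_iInter fun y => isClosed_eq (by fun_prop) (by fun_prop)
    have h5 : IsClosed {G : Ped A → ℝ | ∀ v ∈ V, |G v| ≤ 1} := by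
      simp only [Set.ofPred_forall]
      exact isClosed_iInter fun x => isClosed_iInter fun _ => isClosed_le (by fun_prop) (by fun_prop)
    exact h1.inter (h2.inter (h3.inter (h4.inter h5)))
  have hSc : IsCompact S := by
    refine (isCompact_univ_pi fun x => isCompact_closedBall (0 : ℝ) (t x)⁻¹).of_isClosed_subset hS ?_
    rintro G ⟨-, h2, -, -, h5⟩ x -
    have := h5 _ (htV x)
    rw [h2, abs_mul, abs_of_pos (ht x)] at this
    rw [mem_closedBall_zero_iff, Real.norm_eq_abs, ← one_div, le_div_iff₀' (ht x)]
    exact this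
  have hrange : S ⊆ Set.range fun (τ : realTraces A) (x : Ped A) => (τ.1 x).re := by
    rintro G ⟨h1, h2, h3, h4, h5⟩
    let G' : Ped A →ₗ[ℝ] ℝ := { toFun := G, map_add' := h1, map_smul' := h2 }
    have hG : Continuous G' := by
      refine continuous_of_continuousAt_zero G' ?_
      rw [ContinuousAt, map_zero, Metric.nhds_basis_closedBall.tendsto_right_iff]
      intro ε hε
      filter_upwards [(set_smul_mem_nhds_zero_iff hε.ne').2 hV] with x hx
      obtain ⟨v, hv, rfl⟩ := hx
      rw [mem_closedBall_zero_iff]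
      change ‖G (ε • v)‖ ≤ ε
      rw [h2, norm_mul, Real.norm_of_nonneg hε.le]
      exact mul_le_of_le_one_right hε.le (h5 v hv)
    obtain ⟨τ, hτ⟩ := exists_realTraces_re_eq ⟨G', hG⟩ h3 h4
    exact ⟨τ, funext hτ⟩
  convert isInducing_re.isCompact_preimage' hSc hrange using 1
  ext τ
  refine ⟨fun h => ⟨fun x y => ?_, fun r x => ?_, fun x => ?_, fun x y => ?_, h⟩,
    fun h => h.2.2.2.2⟩
  · exact (congrArg Complex.re (map_add τ.1 x y)).trans (Complex.add_re _ _)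
  · exact (congrArg Complex.re (map_smul τ.1 (r : ℂ) x)).trans (Complex.re_ofReal_mul _ _)
  · exact (congrArg Complex.re (τ.2.2 x)).trans (Complex.conj_re _)
  · exact congrArg Complex.re (τ.2.1 x y)

/-- Bipolar argument: if `â` is below 1 in absolute value on the compact polar of `V` but not in the
image of `V`, a separating trace scaled to value 1 at `a` lies in that polar, a contradiction. -/
theorem isOpenMap_evalₗ : IsOpenMap (evalₗ A) := by
  rw [IsTopologicalAddGroup.isOpenMap_iff_nhds_zero]
  intro W hW
  obtain ⟨V, ⟨h0, hVo, hVb, hVc⟩, hVW⟩ := (nhds_hasBasis_absConvex_open ℝ (Ped A)).mem_iff.1 hW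
  have hK := isCompact_polar (hVo.mem_nhds h0)
  refine Filter.mem_of_superset (CompactConvergenceCLM.hasBasis_nhds_zero.mem_of_mem
    (i := (_, Metric.ball (0 : ℝ) 1)) ⟨hK, Metric.ball_mem_nhds _ one_pos⟩) ?_
  intro f hf
  obtain ⟨a, rfl⟩ := surjective_evalₗ f
  by_contra hcon
  obtain ⟨τ, hτ⟩ := exists_separating_trace hVo hVc ⟨0, h0⟩ (a := a) fun v hv h =>
    hcon (by rw [← h]; exact hVW hv)
  have ht : 0 < (τ.1 a).re := by simpa using hτ 0 h0
  have hre : ∀ x, ((((τ.1 a).re)⁻¹ • τ).1 x).re = (τ.1 a).re⁻¹ * (τ.1 x).re :=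
    fun x => Complex.re_ofReal_mul _ _
  have h := hf (((τ.1 a).re)⁻¹ • τ) fun v hv => by
    have h1 := hτ v hv
    have h2 := hτ (-v) (hVb.neg_mem_iff.2 hv)
    rw [map_neg, Complex.neg_re] at h2
    rw [hre, abs_mul, abs_of_pos (inv_pos.2 ht), inv_mul_le_iff₀ ht, mul_one, abs_le]
    constructor <;> linarith
  rw [evalₗ_apply, hre, inv_mul_cancel₀ ht.ne'] at h
  simp at h

/-- `evalₗ` is a quotient map and factors as `hat` after the continuous `realPart`, so `hat`, being
continuous, is one too. -/
theorem isQuotientMap_hat : IsQuotientMap (hat A) := by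
  refine IsQuotientMap.of_comp Ped.continuous_realPart ?_
    (isOpenMap_evalₗ.isQuotientMap continuous_evalₗ surjective_evalₗ)
  have : (hat A : selfAdjoint (Ped A) → TraceDual A) = fun a : selfAdjoint (Ped A) =>
      evalₗ A (a : Ped A) := by
    ext a τ
    rw [evalₗ_apply]
    rfl
  rw [this]
  exact continuous_evalₗ.comp continuous_subtype_val

end Quotient
-- Lifts of nearly minimal norm
section NormBound

variable {A : Type*} [NonUnitalCStarAlgebra A] [PartialOrder A] [StarOrderedRing A]

/-- The cut-down `(a - δ)₊` is within `δ` of `a`, and `min (t / δ) 1` equals 1 wherever `(t - δ)₊`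
is nonzero. -/
theorem exists_mem_pedZero_norm_sub_le {a : A} (ha : 0 ≤ a) {δ : ℝ} (hδ : 0 < δ) :
    ∃ b ∈ pedZero A, ‖a - b‖ ≤ δ := by
  have hnn : ∀ t ∈ quasispectrum ℝ a, 0 ≤ t := fun t ht => quasispectrum_nonneg_of_nonneg a ha t ht
  let f : ℝ → ℝ := fun t => max (t - δ) 0
  let e : ℝ → ℝ := fun t => min (t / δ) 1
  have hf : Continuous f := by fun_prop
  have he : Continuous e := by fun_prop
  have hf0 : f 0 = 0 := by simp [f, hδ.le]
  have he0 : e 0 = 0 := by simp [e]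
  refine ⟨cfcₙ f a, ⟨cfcₙ_nonneg fun t _ => le_max_right _ _, cfcₙ e a,
    cfcₙ_nonneg fun t ht => le_min (div_nonneg (hnn t ht) hδ.le) zero_le_one, ?_⟩, ?_⟩
  · rw [← cfcₙ_mul e f a]
    refine cfcₙ_congr fun t ht => ?_
    simp only [e, f]
    rcases le_total t δ with h | h
    · rw [max_eq_right (by linarith), mul_zero]
    · rw [min_eq_right ((one_le_div hδ).2 h), one_mul]
  · have hid : cfcₙ (fun t : ℝ => t) a = a := cfcₙ_id' ℝ a
    have : a - cfcₙ f a = cfcₙ (fun t => t - f t) a := by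
      rw [cfcₙ_sub (fun t : ℝ => t) f a, hid]
    rw [this]
    refine norm_cfcₙ_le fun t ht => ?_
    have := hnn t ht
    rw [Real.norm_eq_abs, abs_le]
    simp only [f]
    rcases le_total t δ with h | h
    · rw [max_eq_right (by linarith)]; constructor <;> linarith
    · rw [max_eq_left (by linarith)]; constructor <;> linarith

theorem pedZero_subset_pedPos : pedZero A ⊆ pedPos A :=
  fun a ha => ⟨ha.1, [a], by simpa using ha, by simp⟩

theorem Ped.denseRange_val : DenseRange (Ped.val : Ped A → A) := by
  let S : Submodule ℂ A := Submodule.span ℂ (pedPos A)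
  have h : S.topologicalClosure = ⊤ := by
    rw [eq_top_iff, ← CStarAlgebra.span_nonneg, Submodule.span_le]
    intro a ha
    refine Metric.mem_closure_iff.2 fun ε hε => ?_
    obtain ⟨b, hb, h⟩ := exists_mem_pedZero_norm_sub_le (a := a) ha (half_pos hε)
    refine ⟨b, Submodule.subset_span (pedZero_subset_pedPos hb), ?_⟩
    rw [dist_eq_norm]
    linarith
  intro a
  have ha : a ∈ S.topologicalClosure := by rw [h]; trivial
  have hr : Set.range (Ped.val : Ped A → A) = S := Subtype.range_coe
  rw [hr]
  exact ha

/-- A norm-bounded trace on `Ped(A)` extends to `A`. -/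
theorem exists_isRealTrace_extension (τ : realTraces A)
    (hτ : ∀ x : Ped A, |(τ.1 x).re| ≤ ‖x.val‖) :
    ∃ g : A →ₗ[ℝ] ℝ, IsRealTrace g ∧ (∀ x, |g x| ≤ ‖x‖) ∧
      ∀ x : Ped A, g x.val = (τ.1 x).re := by
  let p : Submodule ℝ A := (Submodule.span ℂ (pedPos A)).restrictScalars ℝ
  let f₀ : p →ₗ[ℝ] ℝ :=
    { toFun := fun x => (τ.1 (show Ped A from x)).re
      map_add' := fun x y => (congrArg Complex.re (map_add τ.1 (show Ped A from x)
        (show Ped A from y))).trans (Complex.add_re _ _)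
      map_smul' := fun r x => (congrArg Complex.re (map_smul τ.1 (r : ℂ)
        (show Ped A from x))).trans (Complex.re_ofReal_mul _ _) }
  let f : StrongDual ℝ p := f₀.mkContinuous 1 fun x => by
    rw [one_mul]
    exact hτ x
  obtain ⟨g, hg, hgn⟩ := exists_extension_norm_eq p f
  have hgv : ∀ x : Ped A, g x.val = (τ.1 x).re := fun x => hg x
  refine ⟨g.toLinearMap, ⟨?_, ?_⟩, fun x => ?_, hgv⟩
  · intro x
    refine Ped.denseRange_val.induction_on (p := fun x => g (star x) = g x) x
      (isClosed_eq (by fun_prop) (by fun_prop)) fun x => ?_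
    rw [← Ped.val_star, hgv, hgv]
    exact (congrArg Complex.re (τ.2.2 x)).trans (Complex.conj_re _)
  · intro x y
    refine Ped.denseRange_val.induction_on₂ (p := fun x y => g (x * y) = g (y * x))
      (isClosed_eq (by fun_prop) (by fun_prop)) (fun x y => ?_) x y
    rw [← Ped.val_mul, ← Ped.val_mul, hgv, hgv, τ.2.1 x y]
  · refine (g.le_opNorm x).trans ?_
    rw [hgn]
    exact mul_le_of_le_one_left (norm_nonneg x) (f₀.mkContinuous_norm_le zero_le_one _)

/-- Multiplying `x` by the conjugate of `τ x` makes the value the real number `‖τ x‖ ^ 2`. -/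
theorem norm_apply_le_of_abs_re_le (τ : realTraces A)
    (hτ : ∀ x : Ped A, |(τ.1 x).re| ≤ ‖x.val‖) (x : Ped A) : ‖τ.1 x‖ ≤ ‖x.val‖ := by
  have h := (le_abs_self _).trans (hτ (star (τ.1 x) • x))
  have e1 : τ.1 (star (τ.1 x) • x) = star (τ.1 x) * τ.1 x := map_smul τ.1 _ x
  have e2 : (star (τ.1 x) • x).val = star (τ.1 x) • x.val := rfl
  rw [e1, e2, norm_smul, norm_star, Complex.star_def, Complex.conj_mul', ← Complex.ofReal_pow,
    Complex.ofReal_re, sq] at h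
  rcases (norm_nonneg (τ.1 x)).eq_or_lt with h0 | h0
  · rw [← h0]; exact norm_nonneg _
  · exact le_of_mul_le_mul_left h h0

/-- For `c > 0` the restriction of `c⁻¹ • E` to `Ped(A)` is the real part of a contractive positive
trace; for `c = 0` the functional is zero. -/
theorem abs_le_mul_of_forall_contractive {E : A →ₗ[ℝ] ℝ} (hE : IsRealTrace E)
    (hpos : ∀ a, 0 ≤ a → 0 ≤ E a) {c : ℝ} (hc : 0 ≤ c) (hEc : ∀ x, |E x| ≤ c * ‖x‖) {a : Ped A}
    {s : ℝ} (hs : ∀ τ ∈ contractivePositiveTraces A, |(τ.1 a).re| ≤ s) :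
    |E a.val| ≤ c * s := by
  rcases hc.eq_or_lt with rfl | hc
  · simpa using hEc a.val
  let E' : A →L[ℝ] ℝ := (c⁻¹ • E).mkContinuous 1 fun x => by
    rw [LinearMap.smul_apply, smul_eq_mul, Real.norm_eq_abs, abs_mul, abs_of_pos (inv_pos.2 hc),
      inv_mul_le_iff₀ hc, one_mul]
    exact hEc x
  have hE' : ∀ x, E' x = c⁻¹ * E x := fun x => rfl
  obtain ⟨τ, hτ⟩ := exists_realTraces_re_eq
    ⟨E'.toLinearMap ∘ₗ (Ped.valₗ A).restrictScalars ℝ, E'.continuous.comp Ped.continuous_val⟩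
    (fun x => congrArg (c⁻¹ * ·) (hE.1 x.val)) (fun x y => congrArg (c⁻¹ * ·) (hE.2 x.val y.val))
  have hτ' : ∀ x : Ped A, (τ.1 x).re = c⁻¹ * E x.val := hτ
  have hbd : ∀ x : Ped A, |(τ.1 x).re| ≤ ‖x.val‖ := fun x => by
    rw [hτ', abs_mul, abs_of_pos (inv_pos.2 hc), inv_mul_le_iff₀ hc]
    exact hEc x.val
  have hmem : τ ∈ contractivePositiveTraces A :=
    ⟨fun x hx => by rw [hτ']; exact mul_nonneg (inv_nonneg.2 hc.le) (hpos _ hx),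
      norm_apply_le_of_abs_re_le τ hbd⟩
  have := hs τ hmem
  rwa [hτ', abs_mul, abs_of_pos (inv_pos.2 hc), inv_mul_le_iff₀ hc] at this

/-- A norm-contractive self-adjoint trace is bounded by the contractive positive traces. -/
theorem re_le_of_forall_contractive (τ : realTraces A)
    (hτ : ∀ x : Ped A, |(τ.1 x).re| ≤ ‖x.val‖) {a : Ped A} {s : ℝ} (hs0 : 0 ≤ s)
    (hs : ∀ σ ∈ contractivePositiveTraces A, |(σ.1 a).re| ≤ s) : (τ.1 a).re ≤ s := by
  obtain ⟨g, hg, hgb, hgτ⟩ := exists_isRealTrace_extension τ hτ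
  obtain ⟨E, F, c, d, rfl, hc, hd, hcd, hE, hF, hE0, hF0, hEc, hFd⟩ :=
    exists_trace_decomposition hg hgb
  have h1 := (abs_le.1 (abs_le_mul_of_forall_contractive hE hE0 hc hEc hs)).2
  have h2 := (abs_le.1 (abs_le_mul_of_forall_contractive hF hF0 hd hFd hs)).1
  -- `E a - F a ≤ c * s + d * s ≤ s`, by `c + d ≤ 1`.
  rw [← hgτ, LinearMap.sub_apply]
  nlinarith [mul_le_mul_of_nonneg_right hcd hs0]

/-- The norm ball of radius `r` is open in `Ped(A)`. If its image missed `â`, a separating trace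
scaled to value `r` at `a` would be norm-contractive, hence at most `s < r` at `a`. -/
theorem exists_evalₗ_eq_norm_lt {a : Ped A} {s r : ℝ} (hs0 : 0 ≤ s) (hsr : s < r)
    (hs : ∀ σ ∈ contractivePositiveTraces A, |(σ.1 a).re| ≤ s) :
    ∃ v : Ped A, evalₗ A v = evalₗ A a ∧ ‖v.val‖ < r := by
  by_contra! hcon
  have hr : 0 < r := hs0.trans_lt hsr
  let V : Set (Ped A) := (Ped.valₗ A).restrictScalars ℝ ⁻¹' Metric.ball 0 r
  have hmem : ∀ {v : Ped A}, v ∈ V ↔ ‖v.val‖ < r := mem_ball_zero_iff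
  have h0 : (0 : Ped A) ∈ V := hmem.2 ((norm_zero (E := A)).trans_lt hr)
  obtain ⟨τ, hτ⟩ := exists_separating_trace (V := V)
    (Metric.isOpen_ball.preimage Ped.continuous_val) ((convex_ball 0 r).linear_preimage _)
    ⟨0, h0⟩ (a := a)
    fun v hv h => (hcon v h).not_gt (hmem.1 hv)
  have ht : 0 < (τ.1 a).re := by simpa using hτ 0 h0
  set t := (τ.1 a).re
  have hre : ∀ x, (((r / t) • τ).1 x).re = r / t * (τ.1 x).re := fun x => Complex.re_ofReal_mul _ _
  have hle : ∀ x : Ped A, (((r / t) • τ).1 x).re ≤ ‖x.val‖ := by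
    intro x
    refine le_of_forall_gt_imp_ge_of_dense fun η hη => ?_
    have hη0 : 0 < η := (norm_nonneg _).trans_lt hη
    -- For `η > ‖x‖` this multiple of `x` is in the ball; letting `η` tend to `‖x‖` gives
    -- contractivity.
    have h := hτ ((r / η) • x) (hmem.2 (by
      have e : ((r / η) • x).val = (r / η) • x.val := rfl
      rw [e, norm_smul, Real.norm_of_nonneg (by positivity), div_mul_eq_mul_div,
        div_lt_iff₀ hη0]
      exact mul_lt_mul_of_pos_left hη hr))
    have e : (τ.1 ((r / η) • x)).re = r / η * (τ.1 x).re :=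
      (congrArg Complex.re (map_smul τ.1 ((r / η : ℝ) : ℂ) x)).trans (Complex.re_ofReal_mul _ _)
    rw [e, div_mul_eq_mul_div, div_lt_iff₀ hη0] at h
    rw [hre, div_mul_eq_mul_div, div_le_iff₀ ht]
    linarith
  have h := re_le_of_forall_contractive ((r / t) • τ) (fun x => abs_le'.2 ⟨hle x, by
    have e : (-x).val = -x.val := rfl
    have := hle (-x)
    rwa [map_neg, Complex.neg_re, e, norm_neg] at this⟩) hs0 hs
  rw [hre, div_mul_cancel₀ _ ht.ne'] at h
  linarith

theorem norm_val_realPart_le (v : Ped A) : ‖(realPart v : Ped A).val‖ ≤ ‖v.val‖ := by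
  have : (realPart v : Ped A).val = (realPart v.val : A) := rfl
  rw [this]
  exact realPart.norm_le v.val

end NormBound
end PedersenTrace

theorem theorem4p2 {A : Type*} [NonUnitalCStarAlgebra A] [PartialOrder A] [StarOrderedRing A] :
    Topology.IsQuotientMap (PedersenTrace.hat A) ∧
    ∀ f : PedersenTrace.TraceDual A,
      BddAbove ((fun τ => |f τ|) '' PedersenTrace.contractivePositiveTraces A) ∧
      ∀ ε : ℝ, 0 < ε → ∃ a : selfAdjoint (PedersenTrace.Ped A),
        PedersenTrace.hat A a = f ∧
        ‖(a : PedersenTrace.Ped A).val‖ ≤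
          sSup ((fun τ => |f τ|) '' PedersenTrace.contractivePositiveTraces A) + ε := by
  refine ⟨PedersenTrace.isQuotientMap_hat, fun f => ?_⟩
  obtain ⟨a, rfl⟩ := PedersenTrace.surjective_evalₗ f
  have hb : BddAbove ((fun τ => |PedersenTrace.evalₗ A a τ|) ''
      PedersenTrace.contractivePositiveTraces A) := by
    refine ⟨‖a.val‖, ?_⟩
    rintro _ ⟨τ, hτ, rfl⟩
    simp only [PedersenTrace.evalₗ_apply]
    exact (Complex.abs_re_le_norm _).trans (hτ.2 a)
  refine ⟨hb, fun ε hε => ?_⟩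
  have hs : 0 ≤ sSup ((fun τ => |PedersenTrace.evalₗ A a τ|) ''
      PedersenTrace.contractivePositiveTraces A) :=
    Real.sSup_nonneg (by rintro _ ⟨τ, -, rfl⟩; exact abs_nonneg _)
  obtain ⟨v, hv, hvn⟩ := PedersenTrace.exists_evalₗ_eq_norm_lt (a := a) hs
    (lt_add_of_pos_right _ hε) fun σ hσ => by
      have := le_csSup hb ⟨σ, hσ, rfl⟩
      simpa only [PedersenTrace.evalₗ_apply] using this
  -- Passing to the real part makes the lift self-adjoint, keeps its image and does not increase the
  -- norm.
  exact ⟨realPart v, hv, (PedersenTrace.norm_val_realPart_le v).trans hvn.le⟩
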